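/- Let $G=(V,L)$ be a finite simple graph, $M\subseteq V$ a set of monitors and $\mu_1\ne\mu_2$ two monitors. Let $H=G^*_{ex}$ be the graph obtained from $G$ by adding two virtual monitors $\mu_1',\mu_2'$, a virtual root $r$, the virtual links $\mu_1'\mu,\ \mu_2'\mu$ for all $\mu\in M$, and the virtual links $r\mu_1',\ r\mu_2',\ r\mu_2$. A nonseparating ear decomposition of $H$ is a sequence of ears $\mathcal E_1,\dots,\mathcal E_{n_e}$ ($n_e\ge 2$) covering all nodes of $H$ such that: $\mathcal E_1$ is an induced cycle; for $i\ge2$, $\mathcal E_i$ is a simple path with two distinct end-points, chordless except that its end-points may be adjacent, which has exactly its end-points in common with $\mathcal E_1\cup\dots\cup\mathcal E_{i-1}$; for each $i<n_e$ the graph $H\setminus(\mathcal E_1\cup\dots\cup\mathcal E_i)$ is connected, and every internal node of $\mathcal E_i$ (every node, if $i=1$) has a neighbour in it; and $\mathcal E_{n_e}$ has three nodes and its internal node is on no other ear. Let such a decomposition be given in which $\mathcal E_1=r\mu_1'\mu_1\mu_2'r$, and in which the internal node of $\mathcal E_{n_e}$ is $\mu_2$ and the end-points of $\mathcal E_{n_e}$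 are not adjacent. Let $g(v)$ be the index of the first ear containing $v$. Let $f$ be the s-t numbering obtained by starting with $f(r)=1,\ f(\mu_2')=2,\ f(\mu_1)=3,\ f(\mu_1')=4$ and processing $\mathcal E_2,\dots,\mathcal E_{n_e}$ in turn: if $\mathcal E_i$ runs from $v_1$ to $v_2$ with $f(v_1)<f(v_2)=\eta$ and has $\psi$ internal nodes, raise all existing numbers $\ge\eta$ by $\psi$ and number the internal nodes $\eta,\dots,\eta+\psi-1$ in the direction from $v_1$ to $v_2$. Trees $T_1,T_2,T_3$ are built by choosing for each node $v\neq r$ and each $i$ a parent $p_i(v)$ adjacent to $v$ in $H$, arbitrarily subject to the following rules. * $p_1(\mu_2)=r$, and $g(p_1(v))>g(v)$ for all other $v$. * $p_2(\mu_2')=r$, and $p_2(v)\ne r$, $f(p_2(v))<f(v)$, $g(p_2(v))\le g(v)$ for all other $v$. * $p_3(\mu_1')=r$, and $f(p_3(v))>f(v)$, $g(p_3(v))\le g(v)$ for all other $v$. For $v\in V$ let $S_i(v)$ be the segment of the path from $v$ to $r$ along $T_i$ that ends at the first monitor after $v$ (it is $v$ alone if the first link of that path is virtual). A tree link is a link of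 $G$ lying on some $T_i$. STPC produces the following paths, regarded as subgraphs of $G$: $S_1(v),S_2(v),S_3(v)$ for each monitor $v$, and $S_1(v)\cup S_2(v)$, $S_2(v)\cup S_3(v)$, $S_1(v)\cup S_3(v)$ for each non-monitor $v$, those without links being discarded; and, for each non-tree link $l$ of $G$, one auxiliary path, namely a simple path in $G$ between two distinct monitors that contains $l$ and all of whose other links are tree links. Then parents obeying these rules exist, and for every choice of them: $T_1,T_2,T_3$ are independent spanning trees of $H$ with respect to $r$ (for each $v$, the paths from $v$ to $r$ in two different trees share no node other than $v$ and $r$); each non-tree link of $G$ has an auxiliary path; and, for every choice of the auxiliary paths, all paths produced by STPC are simple paths between two distinct monitors, the number of distinct paths produced equals the number $|L|$ of links of $G$, and these paths are linearly independent, i.e. the rows of their $0/1$ measurement matrix (rows indexed by the distinct paths, columns by the links of $G$) are linearly independent over $\mathbb R$, so that this matrix is square and of full rank $|L|$. -/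

import Mathlib

namespace STPC

/-! ### The augmented graph -/

/-- Nodes of the augmented graph: the real nodes, the two virtual monitors `vm₁`, `vm₂`, and the
virtual root. -/
inductive ExtNode (V : Type*) where
  | real (v : V)
  | vm₁
  | vm₂
  | root

/-- The augmented graph: `G`, virtual links from both virtual monitors to all monitors in `M`,
and three virtual links from the root, to `vm₁`, `vm₂` and the real monitor `μ₂`. -/
def extGraph {V : Type*} (G : SimpleGraph V) (M : Set V) (μ₂ : V) : SimpleGraph (ExtNode V) where
  Adj
    | .real u, .real v => G.Adj u v
    | .real u, .vm₁ => u ∈ M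
    | .vm₁, .real u => u ∈ M
    | .real u, .vm₂ => u ∈ M
    | .vm₂, .real u => u ∈ M
    | .root, .vm₁ => True
    | .vm₁, .root => True
    | .root, .vm₂ => True
    | .vm₂, .root => True
    | .root, .real u => u = μ₂
    | .real u, .root => u = μ₂
    | _, _ => False
  symm := ⟨by
    rintro (u | _ | _ | _) (v | _ | _ | _) h <;> first | exact h | exact G.adj_symm h⟩
  loopless := ⟨by rintro (u | _ | _ | _) h <;> first | exact h | exact G.loopless.irrefl u h⟩

/-! ### Nonseparating ear decompositions -/

/-- The internal nodes of a path, given by its list of nodes. -/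
def innerNodes {W : Type*} (P : List W) : List W := P.tail.dropLast

/-- The nodes `c₀, …, c_{k-1}` form an induced cycle `c₀ c₁ ⋯ c_{k-1} c₀` of `H`. -/
def IsInducedCycle {W : Type*} (H : SimpleGraph W) (C : List W) : Prop :=
  3 ≤ C.length ∧ C.Nodup ∧
    ∀ (i j : ℕ) (hi : i < C.length) (hj : j < C.length),
      H.Adj C[i] C[j] ↔ (j = (i + 1) % C.length ∨ i = (j + 1) % C.length)

/-- The list `P` is a simple path of `H` with two distinct end-points and without chords, except
that the two end-points may be adjacent. -/
def IsEarPath {W : Type*} (H : SimpleGraph W) (P : List W) : Prop :=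
  2 ≤ P.length ∧ P.Nodup ∧ P.IsChain H.Adj ∧
    ∀ (i j : ℕ) (hj : j < P.length) (hij : i + 1 < j),
      H.Adj (P[i]'(by omega)) P[j] → i = 0 ∧ j + 1 = P.length

/-- The nodes on the ears `E 1, …, E i`. -/
def covered {W : Type*} (E : ℕ → List W) (i : ℕ) : Set W :=
  {v | ∃ j, 1 ≤ j ∧ j ≤ i ∧ v ∈ E j}

/-- `E 1, …, E n` is a nonseparating ear decomposition of `H`. -/
structure IsNonsepEarDecomp {W : Type*} (H : SimpleGraph W) (n : ℕ) (E : ℕ → List W) : Prop where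
  two_le : 2 ≤ n
  /-- every node lies on some ear -/
  cover : ∀ v, v ∈ covered E n
  /-- the first ear is an induced cycle -/
  cycle : IsInducedCycle H (E 1)
  /-- every other ear is a path -/
  path : ∀ i, 2 ≤ i → i ≤ n → IsEarPath H (E i)
  /-- whose end-points, and only these, lie on earlier ears -/
  ends : ∀ i, 2 ≤ i → i ≤ n → ∀ v ∈ E i, v ∈ covered E (i - 1) ↔ v ∉ innerNodes (E i)
  /-- what remains after removing the first `i` ears is connected -/
  connected : ∀ i, 1 ≤ i → i < n → (H.induce (covered E i)ᶜ).Connected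
  /-- every node of the first cycle has a neighbour outside it -/
  nbr_cycle : ∀ v ∈ E 1, ∃ w, H.Adj v w ∧ w ∉ covered E 1
  /-- every internal node of a later ear, the last one excepted, has a neighbour not yet covered -/
  nbr_path : ∀ i, 2 ≤ i → i < n → ∀ v ∈ innerNodes (E i), ∃ w, H.Adj v w ∧ w ∉ covered E i
  /-- the last ear has three nodes -/
  last_length : (E n).length = 3
  /-- and its internal node lies on no other ear -/
  last_inner : ∀ v ∈ innerNodes (E n), ∀ j, 1 ≤ j → j < n → v ∉ E j

/-- The ear decompositions used by the algorithm: the first ear is `root vm₁ μ₁ vm₂ root`, and the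
last one has `μ₂` as its internal node and is an induced path (its end-points are not adjacent). -/
structure IsEarInput {V : Type*} (G : SimpleGraph V) (M : Set V) (μ₁ μ₂ : V) (n : ℕ)
    (E : ℕ → List (ExtNode V)) : Prop where
  decomp : IsNonsepEarDecomp (extGraph G M μ₂) n E
  first : E 1 = [.root, .vm₁, .real μ₁, .vm₂]
  last : ∃ a b, E n = [a, .real μ₂, b] ∧ ¬ (extGraph G M μ₂).Adj a b

/-- Ear level of `v`: the index of the first ear containing `v`. -/
noncomputable def earLevel {W : Type*} (n : ℕ) (E : ℕ → List W) (v : W) : ℕ :=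
  sInf {i | 1 ≤ i ∧ i ≤ n ∧ v ∈ E i}

/-! ### The s-t numbering -/

/-- The path `P`, traversed from the end-point with the smaller number to the one with the larger
number. -/
def orient {W : Type*} (f : W → ℕ) (P : List W) : List W :=
  if P.head?.elim 0 f < P.getLast?.elim 0 f then P else P.reverse

open Classical in
/-- One step of the numbering: the larger number at an end-point of the ear is `η`; existing
numbers `≥ η` are raised by the number of internal nodes of the ear, and these nodes get the
numbers `η, η + 1, …`. Nodes that have no number yet carry the value `0`. -/
noncomputable def stStep {W : Type*} (f : W → ℕ) (P : List W) (w : W) : ℕ :=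
  let Q := orient f P
  let η := Q.getLast?.elim 0 f
  if w ∈ innerNodes Q then η + (innerNodes Q).idxOf w
  else if η ≤ f w then f w + (innerNodes Q).length
  else f w

open Classical in
/-- The numbering of the first ear. -/
noncomputable def stInit {V : Type*} (μ₁ : V) : ExtNode V → ℕ
  | .root => 1
  | .vm₂ => 2
  | .real v => if v = μ₁ then 3 else 0
  | .vm₁ => 4

/-- The s-t numbers after the ears `E 1, …, E i` have been processed. -/
noncomputable def stNum {V : Type*} (μ₁ : V) (E : ℕ → List (ExtNode V)) : ℕ → ExtNode V → ℕ
  | 0 => stInit μ₁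
  | 1 => stInit μ₁
  | i + 2 => stStep (stNum μ₁ E (i + 1)) (E (i + 2))

/-! ### The three spanning trees -/

/-- `p i v` is the next node after `v` on the way to the root along the `i`-th tree. The parents
are arbitrary choices subject to the three rules of the construction. -/
structure IsParentChoice {V : Type*} (G : SimpleGraph V) (M : Set V) (μ₁ μ₂ : V) (n : ℕ)
    (E : ℕ → List (ExtNode V)) (p : Fin 3 → ExtNode V → ExtNode V) : Prop where
  first₁ : p 0 (.real μ₂) = .root
  rule₁ : ∀ v, v ≠ .root → v ≠ .real μ₂ →
    (extGraph G M μ₂).Adj v (p 0 v) ∧ earLevel n E v < earLevel n E (p 0 v)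
  first₂ : p 1 .vm₂ = .root
  rule₂ : ∀ v, v ≠ .root → v ≠ .vm₂ →
    (extGraph G M μ₂).Adj v (p 1 v) ∧ p 1 v ≠ .root ∧
      stNum μ₁ E n (p 1 v) < stNum μ₁ E n v ∧ earLevel n E (p 1 v) ≤ earLevel n E v
  first₃ : p 2 .vm₁ = .root
  rule₃ : ∀ v, v ≠ .root → v ≠ .vm₁ →
    (extGraph G M μ₂).Adj v (p 2 v) ∧
      stNum μ₁ E n v < stNum μ₁ E n (p 2 v) ∧ earLevel n E (p 2 v) ≤ earLevel n E v

/-- The graph with the links `v (q v)` for all nodes `v` other than the root. -/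
def parentGraph {V : Type*} (q : ExtNode V → ExtNode V) : SimpleGraph (ExtNode V) :=
  SimpleGraph.fromRel fun v w => v ≠ .root ∧ w = q v

/-- The graphs `T i` are independent spanning trees of `H` with respect to `r`: spanning trees such
that, for every node `v`, the paths from `v` to `r` in different trees are internally disjoint. -/
def AreIndepSpanningTrees {W ι : Type*} (H : SimpleGraph W) (r : W) (T : ι → SimpleGraph W) :
    Prop :=
  (∀ i, T i ≤ H ∧ (T i).IsTree) ∧
    ∀ i j, i ≠ j → ∀ (v : W) (P : (T i).Walk v r) (Q : (T j).Walk v r), P.IsPath → Q.IsPath →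
      ∀ x, x ∈ P.support → x ∈ Q.support → x = v ∨ x = r

/-- The links of `G` lying on at least one of the trees. -/
def treeLinks {V : Type*} (G : SimpleGraph V) (p : Fin 3 → ExtNode V → ExtNode V) :
    Set (Sym2 V) :=
  {l | l ∈ G.edgeSet ∧ ∃ i, l.map ExtNode.real ∈ (parentGraph (p i)).edgeSet}

/-! ### Measurement paths -/

/-- `P` is a simple path of `G` (as a graph) between two distinct monitors. -/
def IsMeasurementPath {V : Type*} (G : SimpleGraph V) (M : Set V) (P : G.Subgraph) : Prop :=
  ∃ (a b : V) (w : G.Walk a b), a ∈ M ∧ b ∈ M ∧ a ≠ b ∧ w.IsPath ∧ P = w.toSubgraph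

/-- `S` is the path segment from `v` towards the root along the tree with parent map `q`, stopped
at the first monitor after `v`. If the tree leaves `v` through a virtual link, then the
segment consists of `v` alone. -/
inductive IsSegment {V : Type*} (G : SimpleGraph V) (M : Set V) (q : ExtNode V → ExtNode V) :
    V → G.Subgraph → Prop
  | virtual (v : V) (h : ∀ w, q (.real v) ≠ .real w) :
      IsSegment G M q v (G.singletonSubgraph v)
  | hit (v w : V) (h : q (.real v) = .real w) (hw : w ∈ M) (ha : G.Adj v w) :
      IsSegment G M q v (G.subgraphOfAdj ha)
  | step (v w : V) (S : G.Subgraph) (h : q (.real v) = .real w) (hw : w ∉ M) (ha : G.Adj v w)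
      (hS : IsSegment G M q w S) :
      IsSegment G M q v (G.subgraphOfAdj ha ⊔ S)

/-- The paths built from the trees: for a monitor, its three segments; for any other node, the
unions of two of its three segments. Paths without links are discarded. -/
def treePaths {V : Type*} (G : SimpleGraph V) (M : Set V) (p : Fin 3 → ExtNode V → ExtNode V) :
    Set G.Subgraph :=
  {P | P.edgeSet.Nonempty ∧
    ((∃ v ∈ M, ∃ i, IsSegment G M (p i) v P) ∨
      (∃ v ∉ M, ∃ i j S S', i ≠ j ∧ IsSegment G M (p i) v S ∧ IsSegment G M (p j) v S' ∧
        P = S ⊔ S'))}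

/-- `P` is an auxiliary path for the non-tree link `l`: a measurement path through `l` all other
links of which are tree links. -/
def IsAuxPath {V : Type*} (G : SimpleGraph V) (M : Set V) (p : Fin 3 → ExtNode V → ExtNode V)
    (l : Sym2 V) (P : G.Subgraph) : Prop :=
  IsMeasurementPath G M P ∧ l ∈ P.edgeSet ∧ ∀ l' ∈ P.edgeSet, l' ≠ l → l' ∈ treeLinks G p

/-- All paths produced: the paths built from the trees, and the chosen auxiliary path `aux l` of
each non-tree link `l`. -/
def stpcPaths {V : Type*} (G : SimpleGraph V) (M : Set V) (p : Fin 3 → ExtNode V → ExtNode V)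
    (aux : Sym2 V → G.Subgraph) : Set G.Subgraph :=
  treePaths G M p ∪ aux '' (G.edgeSet \ treeLinks G p)

open Classical in
/-- The measurement matrix of a set of paths: the entry is `1` if the link is on the path, and
`0` otherwise. -/
noncomputable def measurementMatrix {V : Type*} (G : SimpleGraph V) (R : Set G.Subgraph) :
    Matrix R G.edgeSet ℝ :=
  Matrix.of fun P l => if (l : Sym2 V) ∈ (P : G.Subgraph).edgeSet then 1 else 0

end STPC

namespace STPC

/-! Let `f` be the final s-t numbering and `g` the ear level. Until they reach the root, the three
trees move in mutually exclusive directions: `g` rises; `f` falls while `g` does not rise; `f` rises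
while `g` does not rise (`Ahead`). Each direction is a strict order on a finite set, so following
parents ends at the root, and no node lies ahead of `v` in two directions, which gives independence.
`IsDirected` isolates this situation, and all statements about measurement paths follow from it.

For the rank it is enough that the paths span the link space and number at most |L|. They span: the
pairwise unions at a non-monitor determine its three segments over ℝ, the difference of the segments
of `v` and of its parent is one tree link, and an auxiliary path minus its tree links is one
non-tree link (`top_le_span`). For the count, label paths by pairs (i, v). A link used in opposite
directions by two trees carries two labels, but then two labels produce the same path, so one of
them can be dropped (`labelPath_mem_image`); the remaining labels inject into the tree links
(`ncard_labels_le`), and each non-tree link adds at most one path.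

It remains to find parents. Processing an ear inserts its internal nodes as a block between its
ends, so each of them gets a lower and a higher neighbour, and later ears preserve the order. The
root stays first, `vm₂` second and `vm₁` last (`isSTNumbering`), so the virtual monitors can serve
as parents of all monitors. That nothing slips between the root and `vm₂` is where the non-adjacency
of the ends of the last ear is used. -/

instance {V : Type*} [Finite V] : Finite (ExtNode V) :=
  Finite.of_surjective
    (fun x : V ⊕ Fin 3 => x.elim ExtNode.real ![ExtNode.vm₁, ExtNode.vm₂, ExtNode.root]) (by
      rintro (v | _ | _ | _)
      · exact ⟨.inl v, rfl⟩
      · exact ⟨.inr 0, rfl⟩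
      · exact ⟨.inr 1, rfl⟩
      · exact ⟨.inr 2, rfl⟩)

/-! ### Parent graphs are trees -/

section ParentGraph

variable {V : Type*} {q : ExtNode V → ExtNode V} {R : ExtNode V → ExtNode V → Prop}

theorem parentGraph_adj_parent {v : ExtNode V} (hv : v ≠ .root) (hq : v ≠ q v) :
    (parentGraph q).Adj v (q v) := by
  simp only [parentGraph, SimpleGraph.fromRel_adj]
  exact ⟨hq, Or.inl ⟨hv, trivial⟩⟩

theorem mem_edgeSet_parentGraph {e : Sym2 (ExtNode V)} (he : e ∈ (parentGraph q).edgeSet) :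
    ∃ v, v ≠ .root ∧ e = s(v, q v) := by
  induction e with
  | _ a b =>
    simp only [SimpleGraph.mem_edgeSet, parentGraph, SimpleGraph.fromRel_adj] at he
    rcases he with ⟨-, ⟨h, rfl⟩ | ⟨h, rfl⟩⟩
    · exact ⟨a, h, rfl⟩
    · exact ⟨b, h, Sym2.eq_swap⟩

/-- If every step to a parent other than the root moves forward in a well-founded transitive
relation, then every node has a walk to the root through nodes ahead of it. -/
theorem exists_walk_root (hwf : WellFounded fun x v => R v x)
    (htrans : ∀ u v w, R u v → R v w → R u w) (hne : ∀ v, v ≠ .root → v ≠ q v)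
    (hstep : ∀ v, v ≠ .root → q v ≠ .root → R v (q v)) (v : ExtNode V) :
    ∃ w : (parentGraph q).Walk v .root, ∀ x ∈ w.support, x = v ∨ x = .root ∨ R v x := by
  induction v using hwf.induction with
  | _ v ih =>
    by_cases hv : v = .root
    · subst hv
      exact ⟨.nil, by simp⟩
    have hadj := parentGraph_adj_parent hv (hne v hv)
    by_cases hq : q v = .root
    · refine ⟨(SimpleGraph.Walk.cons hadj .nil).copy rfl hq, ?_⟩
      simp [hq]
    · obtain ⟨w, hw⟩ := ih (q v) (hstep v hv hq)
      refine ⟨.cons hadj w, ?_⟩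
      intro x hx
      rw [SimpleGraph.Walk.support_cons, List.mem_cons] at hx
      rcases hx with rfl | hx
      · exact Or.inl rfl
      · rcases hw x hx with rfl | h | h
        · exact Or.inr (Or.inr (hstep v hv hq))
        · exact Or.inr (Or.inl h)
        · exact Or.inr (Or.inr (htrans _ _ _ (hstep v hv hq) h))

/-- The walks to the root give connectedness, and every edge is `s(v, q v)` for some `v` other than
the root, so there are too few edges for a cycle. -/
theorem parentGraph_isTree [Finite V] (hwf : WellFounded fun x v => R v x)
    (htrans : ∀ u v w, R u v → R v w → R u w) (hne : ∀ v, v ≠ .root → v ≠ q v)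
    (hstep : ∀ v, v ≠ .root → q v ≠ .root → R v (q v)) : (parentGraph q).IsTree := by
  have hconn : (parentGraph q).Connected := by
    have hreach (v) : (parentGraph q).Reachable v .root :=
      (exists_walk_root hwf htrans hne hstep v).elim fun w _ => ⟨w⟩
    exact { preconnected := fun u v => (hreach u).trans (hreach v).symm, nonempty := ⟨.root⟩ }
  rw [SimpleGraph.isTree_iff_connected_and_card]
  refine ⟨hconn, le_antisymm ?_ hconn.card_vert_le_card_edgeSet_add_one⟩
  have hsub : (parentGraph q).edgeSet ⊆ (fun v => s(v, q v)) '' {v | v ≠ .root} := by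
    intro e he
    obtain ⟨v, hv, rfl⟩ := mem_edgeSet_parentGraph he
    exact ⟨v, hv, rfl⟩
  have h1 := (Set.ncard_le_ncard hsub (Set.toFinite _)).trans (Set.ncard_image_le (Set.toFinite _))
  have h2 := Set.ncard_add_ncard_compl ({.root} : Set (ExtNode V))
  rw [Set.ncard_singleton] at h2
  have h3 : ({.root} : Set (ExtNode V))ᶜ = {v | v ≠ .root} := rfl
  rw [h3] at h2
  rw [Nat.card_coe_set_eq]
  omega

/-- Paths in a tree are unique, so `P` is the bypass of the walk from `exists_walk_root`. -/
theorem mem_support_of_isPath [Finite V] (hwf : WellFounded fun x v => R v x)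
    (htrans : ∀ u v w, R u v → R v w → R u w) (hne : ∀ v, v ≠ .root → v ≠ q v)
    (hstep : ∀ v, v ≠ .root → q v ≠ .root → R v (q v)) {v x : ExtNode V}
    {P : (parentGraph q).Walk v .root} (hP : P.IsPath) (hx : x ∈ P.support) :
    x = v ∨ x = .root ∨ R v x := by
  classical
  obtain ⟨w, hw⟩ := exists_walk_root hwf htrans hne hstep v
  have hac := (parentGraph_isTree hwf htrans hne hstep).isAcyclic
  have := (hac.subsingleton_path v .root).elim ⟨P, hP⟩ ⟨w.bypass, w.bypass_isPath⟩
  simp only [Subtype.mk.injEq] at this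
  subst this
  exact hw x (w.support_bypass_subset_support hx)

end ParentGraph

/-! ### Three parent maps moving in different directions -/

/-- The node `x` lies ahead of `v` in direction `i`: at a larger level, or at no larger level and
with a smaller, respectively larger, number. -/
def Ahead {W : Type*} (f g : W → ℕ) (i : Fin 3) (v x : W) : Prop :=
  ![g v < g x, f x < f v ∧ g x ≤ g v, f v < f x ∧ g x ≤ g v] i

section Ahead

variable {W : Type*} {f g : W → ℕ} {i j : Fin 3} {u v x : W}

theorem Ahead.trans (h : Ahead f g i u v) (h' : Ahead f g i v x) : Ahead f g i u x := by
  fin_cases i <;> simp [Ahead] at * <;> omega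

theorem Ahead.irrefl (h : Ahead f g i v v) : False := by
  fin_cases i <;> simp [Ahead] at *

/-- Direction 0 raises `g` while the other two do not, and those two move `f` in opposite senses.
Independence of the trees and disjointness of segments both rest on this. -/
theorem Ahead.eq_index (h : Ahead f g i v x) (h' : Ahead f g j v x) : i = j := by
  fin_cases i <;> fin_cases j <;> simp [Ahead] at * <;> omega

theorem Ahead.wellFounded [Finite W] (f g : W → ℕ) (i : Fin 3) :
    WellFounded fun x v => Ahead f g i v x := by
  let r : W → W → Prop := fun x v => Ahead f g i v x
  have : IsTrans W r := ⟨fun _ _ _ h h' => Ahead.trans h' h⟩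
  have : Std.Irrefl r := ⟨fun _ h => Ahead.irrefl h⟩
  exact Finite.wellFounded_of_trans_of_irrefl r

end Ahead

/-- Three parent maps on the augmented graph, each moving ahead in its own direction until it
reaches the root. -/
structure IsDirected {V : Type*} (G : SimpleGraph V) (M : Set V) (μ₂ : V)
    (p : Fin 3 → ExtNode V → ExtNode V) (f g : ExtNode V → ℕ) : Prop where
  mem : μ₂ ∈ M
  inj : Function.Injective f
  adj : ∀ i v, v ≠ .root → (extGraph G M μ₂).Adj v (p i v)
  ahead : ∀ i v, v ≠ .root → p i v ≠ .root → Ahead f g i v (p i v)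

theorem IsDirected.areIndepSpanningTrees {V : Type*} [Finite V] {G : SimpleGraph V} {M : Set V}
    {μ₂ : V} {p : Fin 3 → ExtNode V → ExtNode V} {f g : ExtNode V → ℕ}
    (h : IsDirected G M μ₂ p f g) :
    AreIndepSpanningTrees (extGraph G M μ₂) .root fun i => parentGraph (p i) := by
  have hne (i v) (hv : v ≠ ExtNode.root) : v ≠ p i v := (h.adj i v hv).ne
  have htrans (i) : ∀ u v w, Ahead f g i u v → Ahead f g i v w → Ahead f g i u w :=
    fun _ _ _ => Ahead.trans
  refine ⟨fun i => ⟨fun a b hab => ?_, parentGraph_isTree (Ahead.wellFounded f g i) (htrans i)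
    (hne i) (h.ahead i)⟩, fun i j hij v P Q hP hQ x hxP hxQ => ?_⟩
  · simp only [parentGraph, SimpleGraph.fromRel_adj] at hab
    rcases hab with ⟨-, ⟨h1, rfl⟩ | ⟨h1, rfl⟩⟩
    · exact h.adj i a h1
    · exact (h.adj i b h1).symm
  · have h1 := mem_support_of_isPath (Ahead.wellFounded f g i) (htrans i) (hne i) (h.ahead i) hP hxP
    have h2 := mem_support_of_isPath (Ahead.wellFounded f g j) (htrans j) (hne j) (h.ahead j) hQ hxQ
    by_contra! hx
    simp only [hx.1, hx.2, false_or] at h1 h2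
    exact hij (h1.eq_index h2)


/-! ### Segments -/

theorem isPath_append {V : Type*} {G : SimpleGraph V} {u v w : V} {P : G.Walk u v} {Q : G.Walk v w}
    (hP : P.IsPath) (hQ : Q.IsPath) (h : ∀ x ∈ P.support, x ∈ Q.support → x = v) :
    (P.append Q).IsPath := by
  rw [SimpleGraph.Walk.isPath_def, SimpleGraph.Walk.support_append]
  have hQ' := hQ.support_nodup
  rw [← SimpleGraph.Walk.cons_tail_support, List.nodup_cons] at hQ'
  refine List.Nodup.append hP.support_nodup hQ'.2 fun x hx hx' => ?_
  obtain rfl := h x hx (List.mem_of_mem_tail hx')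
  exact hQ'.1 hx'

theorem IsSegment.unique {V : Type*} {G : SimpleGraph V} {M : Set V}
    {q : ExtNode V → ExtNode V} {v : V} {S S' : G.Subgraph} (h : IsSegment G M q v S)
    (h' : IsSegment G M q v S') : S = S' := by
  induction h generalizing S' with
  | virtual v hv =>
    cases h' with
    | virtual => rfl
    | hit _ w hw => exact absurd hw (hv w)
    | step _ w _ hw => exact absurd hw (hv w)
  | hit v w h hw ha =>
    cases h' with
    | virtual _ hv => exact absurd h (hv w)
    | hit _ w' h' =>
      obtain rfl : w = w' := by simpa using h.symm.trans h'
      rfl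
    | step _ w' _ h' hw' =>
      obtain rfl : w = w' := by simpa using h.symm.trans h'
      exact absurd hw hw'
  | step v w S h hw ha hS ih =>
    cases h' with
    | virtual _ hv => exact absurd h (hv w)
    | hit _ w' h' hw' =>
      obtain rfl : w = w' := by simpa using h.symm.trans h'
      exact absurd hw' hw
    | step _ w' S' h' hw' _ hS' =>
      obtain rfl : w = w' := by simpa using h.symm.trans h'
      rw [ih hS']

theorem exists_of_mem_treeLinks {V : Type*} {G : SimpleGraph V}
    {p : Fin 3 → ExtNode V → ExtNode V} {l : Sym2 V} (hl : l ∈ treeLinks G p) :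
    ∃ i v w, p i (.real v) = .real w ∧ l = s(v, w) := by
  obtain ⟨-, i, hi⟩ := hl
  obtain ⟨y, -, hv⟩ := mem_edgeSet_parentGraph hi
  induction l with
  | _ a b =>
    simp only [Sym2.map_mk, Sym2.eq_iff] at hv
    rcases hv with ⟨rfl, hb⟩ | ⟨ha, rfl⟩
    · exact ⟨i, a, b, hb.symm, rfl⟩
    · exact ⟨i, b, a, ha.symm, Sym2.eq_swap⟩

namespace IsDirected

variable {V : Type*} {G : SimpleGraph V} {M : Set V} {μ₂ : V}
  {p : Fin 3 → ExtNode V → ExtNode V} {f g : ExtNode V → ℕ} {i j : Fin 3} {v w x : V}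

section Steps

variable (h : IsDirected G M μ₂ p f g)
include h

theorem adj_real (hw : p i (.real v) = .real w) : G.Adj v w := by
  have := h.adj i (.real v) (by simp)
  rwa [hw] at this

theorem ahead_real (hw : p i (.real v) = .real w) : Ahead f g i (.real v) (.real w) := by
  have := h.ahead i (.real v) (by simp) (by simp [hw])
  rwa [hw] at this

theorem exists_parent_of_notMem (hv : v ∉ M) (i : Fin 3) : ∃ w, p i (.real v) = .real w := by
  have := h.adj i (.real v) (by simp)
  rcases hp : p i (.real v) with w | _ | _ | _ <;> rw [hp] at this
  · exact ⟨w, rfl⟩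
  · exact absurd this hv
  · exact absurd this hv
  · obtain rfl : v = μ₂ := this
    exact absurd h.mem hv

theorem eq_index_of_parent_eq (hi : p i (.real v) = .real w) (hj : p j (.real v) = .real w) :
    i = j :=
  (h.ahead_real hi).eq_index (h.ahead_real hj)

theorem ne_index_of_parent_swap (hi : p i (.real v) = .real w) (hj : p j (.real w) = .real v) :
    i ≠ j := by
  rintro rfl
  exact ((h.ahead_real hi).trans (h.ahead_real hj)).irrefl

theorem mem_treeLinks (hw : p i (.real v) = .real w) : s(v, w) ∈ treeLinks G p := by
  refine ⟨h.adj_real hw, i, ?_⟩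
  have := parentGraph_adj_parent (q := p i) (v := .real v) (by simp) (h.adj i _ (by simp)).ne
  rwa [hw] at this

theorem exists_isSegment [Finite V] (i : Fin 3) (v : V) : ∃ S, IsSegment G M (p i) v S := by
  have hwf := (InvImage.wf ExtNode.real (Ahead.wellFounded f g i))
  induction v using hwf.induction with
  | _ v ih =>
    by_cases hv : ∃ w, p i (.real v) = .real w
    · obtain ⟨w, hw⟩ := hv
      by_cases hM : w ∈ M
      · exact ⟨_, .hit v w hw hM (h.adj_real hw)⟩
      · obtain ⟨S, hS⟩ := ih w (h.ahead_real hw)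
        exact ⟨_, .step v w S hw hM (h.adj_real hw) hS⟩
    · exact ⟨_, .virtual v (by simpa using hv)⟩

theorem ahead_of_mem_verts {S : G.Subgraph} (hS : IsSegment G M (p i) v S) (hx : x ∈ S.verts) :
    x = v ∨ Ahead f g i (.real v) (.real x) := by
  induction hS with
  | virtual v hv => exact Or.inl hx
  | hit v w hw _ ha =>
    rcases hx with rfl | rfl
    · exact Or.inl rfl
    · exact Or.inr (h.ahead_real hw)
  | step v w S hw _ ha _ ih =>
    rcases hx with (rfl | rfl) | hx
    · exact Or.inl rfl
    · exact Or.inr (h.ahead_real hw)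
    · rcases ih hx with rfl | hx
      · exact Or.inr (h.ahead_real hw)
      · exact Or.inr ((h.ahead_real hw).trans hx)

theorem edgeSet_subset_treeLinks {S : G.Subgraph} (hS : IsSegment G M (p i) v S) :
    S.edgeSet ⊆ treeLinks G p := by
  induction hS with
  | virtual v hv => simp
  | hit v w hw _ ha => simpa using h.mem_treeLinks hw
  | step v w S hw _ ha _ ih =>
    rw [SimpleGraph.Subgraph.edgeSet_sup, SimpleGraph.edgeSet_subgraphOfAdj]
    exact Set.union_subset (by simpa using h.mem_treeLinks hw) ih

/-- A segment with a real first link cannot leave through a virtual link before meeting a monitor,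
because non-monitors have only real neighbours. It never returns to `v`, since all its later nodes
are strictly ahead of `v`. -/
theorem exists_walk {S : G.Subgraph} (hS : IsSegment G M (p i) v S)
    (hv : ∃ w, p i (.real v) = .real w) :
    ∃ b ∈ M, b ≠ v ∧ ∃ P : G.Walk v b, P.IsPath ∧ S = P.toSubgraph := by
  induction hS with
  | virtual v hv' => exact absurd hv (by simpa using hv')
  | hit v w hw hM ha =>
    refine ⟨w, hM, ha.ne', .cons ha .nil, ?_, by simp⟩
    simpa using ha.ne
  | step v w S hw hM ha hS ih =>
    obtain ⟨b, hb, -, P, hP, rfl⟩ := ih (h.exists_parent_of_notMem hM i)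
    have hnot (x) (hx : x ∈ P.support) : x ≠ v := by
      have hvw := h.ahead_real hw
      rcases h.ahead_of_mem_verts hS (P.mem_verts_toSubgraph.2 hx) with rfl | h'
      · exact ha.ne'
      · rintro rfl
        exact (hvw.trans h').irrefl
    exact ⟨b, hb, hnot b P.end_mem_support, .cons ha P, hP.cons fun hx => hnot v hx rfl, by simp⟩

end Steps

section Segment

variable [Finite V]

/-- The segment of `v` in the `i`-th tree. -/
noncomputable def segment (h : IsDirected G M μ₂ p f g) (i : Fin 3) (v : V) : G.Subgraph :=
  (h.exists_isSegment i v).choose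

variable (h : IsDirected G M μ₂ p f g)
include h

theorem isSegment_segment (i : Fin 3) (v : V) : IsSegment G M (p i) v (h.segment i v) :=
  (h.exists_isSegment i v).choose_spec

theorem eq_segment {S : G.Subgraph} (hS : IsSegment G M (p i) v S) : S = h.segment i v :=
  hS.unique (h.isSegment_segment i v)

theorem segment_of_mem (hw : p i (.real v) = .real w) (hM : w ∈ M) :
    h.segment i v = G.subgraphOfAdj (h.adj_real hw) :=
  (h.eq_segment (.hit v w hw hM _)).symm

theorem segment_of_notMem (hw : p i (.real v) = .real w) (hM : w ∉ M) :
    h.segment i v = G.subgraphOfAdj (h.adj_real hw) ⊔ h.segment i w :=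
  (h.eq_segment (.step v w _ hw hM _ (h.isSegment_segment i w))).symm

theorem exists_parent_of_edge_segment {e : Sym2 V} (he : e ∈ (h.segment i v).edgeSet) :
    ∃ w, p i (.real v) = .real w := by
  by_contra! hv
  rw [← h.eq_segment (.virtual v hv)] at he
  simp at he

theorem eq_of_mem_segments (hij : i ≠ j) (hi : x ∈ (h.segment i v).verts)
    (hj : x ∈ (h.segment j v).verts) : x = v := by
  rcases h.ahead_of_mem_verts (h.isSegment_segment i v) hi with rfl | hi
  · rfl
  · rcases h.ahead_of_mem_verts (h.isSegment_segment j v) hj with rfl | hj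
    · rfl
    · exact absurd (hi.eq_index hj) hij

theorem notMem_segment_of_mem (hij : i ≠ j) {e : Sym2 V} (hi : e ∈ (h.segment i v).edgeSet) :
    e ∉ (h.segment j v).edgeSet := by
  intro hj
  induction e with
  | _ a b =>
    rw [SimpleGraph.Subgraph.mem_edgeSet] at hi hj
    exact hi.ne ((h.eq_of_mem_segments hij hi.fst_mem hj.fst_mem).trans
      (h.eq_of_mem_segments hij hi.snd_mem hj.snd_mem).symm)

theorem notMem_segment_parent (hw : p i (.real v) = .real w) :
    s(v, w) ∉ (h.segment i w).edgeSet := by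
  intro hv
  rw [SimpleGraph.Subgraph.mem_edgeSet] at hv
  have hvw := h.ahead_real hw
  rcases h.ahead_of_mem_verts (h.isSegment_segment i w) hv.fst_mem with rfl | h'
  · exact hvw.irrefl
  · exact (hvw.trans h').irrefl

theorem edgeSet_segment_nonempty (hw : p i (.real v) = .real w) :
    (h.segment i v).edgeSet.Nonempty := by
  refine ⟨s(v, w), ?_⟩
  by_cases hM : w ∈ M
  · simp [h.segment_of_mem hw hM]
  · simp [h.segment_of_notMem hw hM]

/-! ### Measurement paths -/

theorem isMeasurementPath_segment (hv : v ∈ M) (hw : p i (.real v) = .real w) :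
    IsMeasurementPath G M (h.segment i v) := by
  obtain ⟨b, hb, hne, P, hP, hS⟩ := h.exists_walk (h.isSegment_segment i v) ⟨w, hw⟩
  exact ⟨v, b, P, hv, hb, hne.symm, hP, hS⟩

theorem isMeasurementPath_sup (hv : v ∉ M) (hij : i ≠ j) :
    IsMeasurementPath G M (h.segment i v ⊔ h.segment j v) := by
  obtain ⟨a, ha, hav, P, hP, hPS⟩ :=
    h.exists_walk (h.isSegment_segment i v) (h.exists_parent_of_notMem hv i)
  obtain ⟨b, hb, hbv, Q, hQ, hQS⟩ :=
    h.exists_walk (h.isSegment_segment j v) (h.exists_parent_of_notMem hv j)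
  have hPQ (x) (hx : x ∈ P.support) (hx' : x ∈ Q.support) : x = v := by
    refine h.eq_of_mem_segments hij ?_ ?_
    · rwa [hPS, P.mem_verts_toSubgraph]
    · rwa [hQS, Q.mem_verts_toSubgraph]
  refine ⟨a, b, P.reverse.append Q, ha, hb, ?_, isPath_append hP.reverse hQ ?_, ?_⟩
  · rintro rfl
    exact hav (hPQ a P.end_mem_support Q.end_mem_support)
  · simpa using hPQ
  · rw [SimpleGraph.Walk.toSubgraph_append, SimpleGraph.Walk.toSubgraph_reverse, hPS, hQS]

theorem isMeasurementPath_of_mem_treePaths {P : G.Subgraph} (hP : P ∈ treePaths G M p) :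
    IsMeasurementPath G M P := by
  obtain ⟨hne, ⟨v, hv, i, hS⟩ | ⟨v, hv, i, j, S, S', hij, hS, hS', rfl⟩⟩ := hP
  · obtain rfl := h.eq_segment hS
    obtain ⟨e, he⟩ := hne
    obtain ⟨w, hw⟩ := h.exists_parent_of_edge_segment he
    exact h.isMeasurementPath_segment hv hw
  · rw [h.eq_segment hS, h.eq_segment hS']
    exact h.isMeasurementPath_sup hv hij

/-! ### Auxiliary paths -/

/-- Every node has a path to a monitor along tree links through nodes ahead of it. -/
theorem exists_walk_ahead (i : Fin 3) (v : V) :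
    ∃ b ∈ M, ∃ P : G.Walk v b, P.IsPath ∧ (∀ e ∈ P.edges, e ∈ treeLinks G p) ∧
      ∀ x ∈ P.support, x = v ∨ Ahead f g i (.real v) (.real x) := by
  by_cases hv : v ∈ M
  · exact ⟨v, hv, .nil, by simp, by simp, by simp⟩
  · obtain ⟨b, hb, -, P, hP, hS⟩ :=
      h.exists_walk (h.isSegment_segment i v) (h.exists_parent_of_notMem hv i)
    refine ⟨b, hb, P, hP, fun e he => ?_, fun x hx => ?_⟩
    · apply h.edgeSet_subset_treeLinks (h.isSegment_segment i v)
      rwa [hS, P.mem_edges_toSubgraph]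
    · apply h.ahead_of_mem_verts (h.isSegment_segment i v)
      rwa [hS, P.mem_verts_toSubgraph]

/-- Descend from `v` along the second tree and ascend from `w` along the third, each until a
monitor. The first part has numbers at most `f v`, the second at least `f w`, so they cannot meet.
-/
theorem exists_isAuxPath_of_lt (ha : G.Adj v w) (hvw : f (.real v) < f (.real w)) :
    ∃ P, IsAuxPath G M p s(v, w) P := by
  obtain ⟨a, haM, P, hP, hPt, hPf⟩ := h.exists_walk_ahead 1 v
  obtain ⟨b, hbM, Q, hQ, hQt, hQf⟩ := h.exists_walk_ahead 2 w
  have hle (x) (hx : x ∈ P.support) : f (.real x) ≤ f (.real v) := by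
    rcases hPf x hx with rfl | h'
    · exact le_rfl
    · simp only [Ahead] at h'
      exact h'.1.le
  have hge (x) (hx : x ∈ Q.support) : f (.real w) ≤ f (.real x) := by
    rcases hQf x hx with rfl | h'
    · exact le_rfl
    · simp only [Ahead] at h'
      exact h'.1.le
  have hdisj (x) (hx : x ∈ P.support) (hx' : x ∈ Q.support) : False := by
    have := hle x hx
    have := hge x hx'
    omega
  have hpath : (P.reverse.append (.cons ha Q)).IsPath := by
    refine isPath_append hP.reverse (hQ.cons fun hv => hdisj v P.start_mem_support hv) ?_
    intro x hx hx'
    rw [SimpleGraph.Walk.support_reverse, List.mem_reverse] at hx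
    rw [SimpleGraph.Walk.support_cons, List.mem_cons] at hx'
    exact hx'.resolve_right (hdisj x hx)
  refine ⟨_, ⟨a, b, _, haM, hbM, ?_, hpath, rfl⟩, ?_, fun l hl hne => ?_⟩
  · rintro rfl
    exact hdisj a P.end_mem_support Q.end_mem_support
  · simp
  · rw [SimpleGraph.Walk.mem_edges_toSubgraph] at hl
    simp only [SimpleGraph.Walk.edges_append, SimpleGraph.Walk.edges_reverse,
      SimpleGraph.Walk.edges_cons, List.mem_append, List.mem_reverse, List.mem_cons] at hl
    rcases hl with hl | rfl | hl
    · exact hPt l hl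
    · exact absurd rfl hne
    · exact hQt l hl

theorem exists_isAuxPath {l : Sym2 V} (hl : l ∈ G.edgeSet) : ∃ P, IsAuxPath G M p l P := by
  induction l with
  | _ v w =>
    rw [SimpleGraph.mem_edgeSet] at hl
    rcases lt_trichotomy (f (.real v)) (f (.real w)) with hlt | heq | hlt
    · exact h.exists_isAuxPath_of_lt hl hlt
    · exact absurd (by simpa using h.inj heq) hl.ne
    · rw [Sym2.eq_swap]
      exact h.exists_isAuxPath_of_lt hl.symm hlt

end Segment

end IsDirected


/-! ### Incidence vectors of paths -/

section LinkVec

variable {V : Type*} {G : SimpleGraph V}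

open Classical in
/-- The incidence vector of the links of `P`. -/
noncomputable def linkVec (P : G.Subgraph) : G.edgeSet → ℝ :=
  fun l => if (l : Sym2 V) ∈ P.edgeSet then 1 else 0

theorem linkVec_sup {S S' : G.Subgraph} (h : ∀ e ∈ S.edgeSet, e ∉ S'.edgeSet) :
    linkVec (S ⊔ S') = linkVec S + linkVec S' := by
  ext l
  have := h l
  by_cases h1 : (l : Sym2 V) ∈ S.edgeSet <;> by_cases h2 : (l : Sym2 V) ∈ S'.edgeSet <;>
    simp_all [linkVec, SimpleGraph.Subgraph.edgeSet_sup]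

theorem linkVec_eq_zero {S : G.Subgraph} (h : ¬ S.edgeSet.Nonempty) : linkVec S = 0 := by
  rw [Set.not_nonempty_iff_eq_empty] at h
  ext l
  simp [linkVec, h]

open Classical in
theorem linkVec_eq_sum [Fintype G.edgeSet] (S : G.Subgraph) :
    linkVec S = ∑ l : G.edgeSet, if (l : Sym2 V) ∈ S.edgeSet then Pi.single l 1 else 0 := by
  ext l
  rw [Finset.sum_apply, Finset.sum_eq_single l]
  · by_cases h : (l : Sym2 V) ∈ S.edgeSet <;> simp [linkVec, h]
  · intro b _ hb
    by_cases h : (b : Sym2 V) ∈ S.edgeSet <;> simp [h, hb.symm]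
  · simp

theorem linkVec_subgraphOfAdj [DecidableEq V] {v w : V} (h : G.Adj v w) :
    linkVec (G.subgraphOfAdj h) = Pi.single ⟨s(v, w), h⟩ 1 := by
  ext l
  simp [linkVec, Pi.single_apply, Subtype.ext_iff]

/-- Spanning rows, no more of which than there are links, form a basis. -/
theorem measurementMatrix_of_span_eq_top [Fintype V] [DecidableEq V] [DecidableRel G.Adj]
    {R : Set G.Subgraph} (hspan : ⊤ ≤ Submodule.span ℝ (linkVec '' R))
    (hcard : R.ncard ≤ G.edgeFinset.card) :
    R.ncard = G.edgeFinset.card ∧ LinearIndependent ℝ (measurementMatrix G R).row ∧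
      (measurementMatrix G R).rank = G.edgeFinset.card := by
  classical
  have : Fintype R := Fintype.ofFinite R
  have hrow : Set.range (measurementMatrix G R).row = linkVec '' R := by
    rw [Set.image_eq_range]
    rfl
  rw [← hrow] at hspan
  have hfin : Module.finrank ℝ (G.edgeSet → ℝ) = G.edgeFinset.card := by
    rw [Module.finrank_fintype_fun_eq_card, SimpleGraph.edgeFinset_card]
  have hR : Fintype.card R = R.ncard := by
    rw [← Nat.card_coe_set_eq, Nat.card_eq_fintype_card]
  have hli : LinearIndependent ℝ (measurementMatrix G R).row :=
    linearIndependent_of_top_le_span_of_card_le_finrank hspan (by rw [hR, hfin]; exact hcard)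
  have hrank : (measurementMatrix G R).rank = Fintype.card R := hli.rank_matrix
  have heq : R.ncard = G.edgeFinset.card := by
    rw [← hfin, ← finrank_top ℝ (G.edgeSet → ℝ), ← top_le_iff.1 hspan, ← hR,
      finrank_span_eq_card hli]
  exact ⟨heq, hli, by rw [hrank, hR, heq]⟩

end LinkVec

namespace IsDirected

variable {V : Type*} [Finite V] {G : SimpleGraph V} {M : Set V} {μ₂ : V}
  {p : Fin 3 → ExtNode V → ExtNode V} {f g : ExtNode V → ℕ} {i : Fin 3} {v w : V}
  (h : IsDirected G M μ₂ p f g)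
include h

/-! ### The paths span -/

/-- At a non-monitor only sums of two segments are available; half of two of the sums minus the
third isolates one segment. -/
theorem linkVec_segment_mem {W : Submodule ℝ (G.edgeSet → ℝ)}
    (hW : ∀ P ∈ treePaths G M p, linkVec P ∈ W) (i : Fin 3) (v : V) :
    linkVec (h.segment i v) ∈ W := by
  by_cases hv : v ∈ M
  · by_cases hne : (h.segment i v).edgeSet.Nonempty
    · exact hW _ ⟨hne, Or.inl ⟨v, hv, i, h.isSegment_segment i v⟩⟩
    · rw [linkVec_eq_zero hne]
      exact W.zero_mem
  · have key (j k : Fin 3) (hjk : j ≠ k) :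
        linkVec (h.segment j v) + linkVec (h.segment k v) ∈ W := by
      rw [← linkVec_sup fun _ => h.notMem_segment_of_mem hjk]
      refine hW _ ⟨?_, Or.inr ⟨v, hv, j, k, _, _, hjk, h.isSegment_segment j v,
        h.isSegment_segment k v, rfl⟩⟩
      obtain ⟨w, hw⟩ := h.exists_parent_of_notMem hv j
      rw [SimpleGraph.Subgraph.edgeSet_sup]
      exact (h.edgeSet_segment_nonempty hw).inl
    have hne : ∀ i : Fin 3, i ≠ i + 1 ∧ i ≠ i + 2 ∧ i + 1 ≠ i + 2 := by decide
    obtain ⟨h1, h2, h3⟩ := hne i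
    have := W.smul_mem (1 / 2 : ℝ) (W.sub_mem (W.add_mem (key _ _ h1) (key _ _ h2)) (key _ _ h3))
    convert this using 1
    module

/-- The segment of `v` is its first link followed by the segment of the parent, or nothing more if
the parent is a monitor, so subtraction isolates the link. -/
theorem single_mem [DecidableEq V] {W : Submodule ℝ (G.edgeSet → ℝ)}
    (hW : ∀ P ∈ treePaths G M p, linkVec P ∈ W) {l : G.edgeSet}
    (hl : (l : Sym2 V) ∈ treeLinks G p) : Pi.single l 1 ∈ W := by
  obtain ⟨i, v, w, hw, hvw⟩ := exists_of_mem_treeLinks hl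
  obtain rfl : l = ⟨s(v, w), h.adj_real hw⟩ := Subtype.ext hvw
  rw [← linkVec_subgraphOfAdj]
  have hv := h.linkVec_segment_mem hW i v
  by_cases hM : w ∈ M
  · rwa [h.segment_of_mem hw hM] at hv
  · rw [h.segment_of_notMem hw hM, linkVec_sup] at hv
    · simpa using W.sub_mem hv (h.linkVec_segment_mem hW i w)
    · simpa using h.notMem_segment_parent hw

theorem top_le_span {aux : Sym2 V → G.Subgraph}
    (haux : ∀ l ∈ G.edgeSet \ treeLinks G p, IsAuxPath G M p l (aux l)) :
    ⊤ ≤ Submodule.span ℝ (linkVec '' stpcPaths G M p aux) := by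
  classical
  have := Fintype.ofFinite G.edgeSet
  set W := Submodule.span ℝ (linkVec '' stpcPaths G M p aux) with hWdef
  have hR (P) (hP : P ∈ stpcPaths G M p aux) : linkVec P ∈ W :=
    Submodule.subset_span ⟨P, hP, rfl⟩
  have htree (l : G.edgeSet) (hl : (l : Sym2 V) ∈ treeLinks G p) : Pi.single l (1 : ℝ) ∈ W :=
    h.single_mem (fun P hP => hR P (Or.inl hP)) hl
  have hall (l : G.edgeSet) : Pi.single l (1 : ℝ) ∈ W := by
    by_cases hl : (l : Sym2 V) ∈ treeLinks G p
    · exact htree l hl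
    · obtain ⟨-, hmem, hother⟩ := haux l ⟨l.2, hl⟩
      have haW := hR _ (Or.inr ⟨l, ⟨l.2, hl⟩, rfl⟩)
      -- Split off the unit vector of `l`; all other links of the auxiliary path are tree links,
      -- already in `W`.
      rw [linkVec_eq_sum, ← Finset.add_sum_erase _ _ (Finset.mem_univ l), if_pos hmem] at haW
      refine (W.add_mem_iff_left (W.sum_mem fun e he => ?_)).1 haW
      split_ifs with hmem'
      · exact htree e (hother e hmem' fun heq => Finset.ne_of_mem_erase he (Subtype.ext heq))
      · exact W.zero_mem
  intro x _
  rw [← Finset.univ_sum_single x]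
  refine W.sum_mem fun l _ => ?_
  simpa [← Pi.single_smul] using W.smul_mem (x l) (hall l)

/-! ### Counting the paths -/

open Classical in
/-- The path labelled by the node `v` and the index `i`. -/
noncomputable def labelPath (i : Fin 3) (v : V) : G.Subgraph :=
  if v ∈ M then h.segment i v else h.segment i v ⊔ h.segment (i + 1) v

omit [Finite V] h in
/-- Labels with a real link, except those whose link is also used in the opposite direction by the
next tree. -/
def labels (p : Fin 3 → ExtNode V → ExtNode V) : Set (Fin 3 × V) :=
  {a | ∃ w, p a.1 (.real a.2) = .real w ∧ p (a.1 + 1) (.real w) ≠ .real a.2}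

/-- Suppose tree i goes from `v` to `w` and tree i + 1 from `w` back to `v`. Writing both segments
through the common link shows that (i, v) has the same path as (i, w) if `w` is no monitor, and as
(i + 1, w) if it is. The first case recurses, with `w` ahead of `v`; the second stops at an
admissible label. -/
theorem labelPath_mem_image (i : Fin 3) (v : V) (hw : ∃ w, p i (.real v) = .real w) :
    h.labelPath i v ∈ (fun a : Fin 3 × V => h.labelPath a.1 a.2) '' labels p := by
  have hwf := (InvImage.wf ExtNode.real (Ahead.wellFounded f g i))
  induction v using hwf.induction with
  | _ v ih =>
    obtain ⟨w, hw⟩ := hw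
    by_cases hD : p (i + 1) (.real w) = .real v
    · have hsymm : G.subgraphOfAdj (h.adj_real hD) = G.subgraphOfAdj (h.adj_real hw) :=
        SimpleGraph.subgraphOfAdj_symm _
      by_cases hwM : w ∈ M
      -- Otherwise trees i and i + 2 would both go from `v` to `w`.
      · have hlab : (i + 1, w) ∈ labels p := by
          refine ⟨v, hD, fun h2 => ?_⟩
          have hne : ∀ i : Fin 3, i ≠ i + 1 + 1 := by decide
          exact hne i (h.eq_index_of_parent_eq hw h2)
        refine ⟨(i + 1, w), hlab, ?_⟩
        by_cases hvM : v ∈ M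
        · simp [labelPath, hwM, hvM, h.segment_of_mem hw hwM, h.segment_of_mem hD hvM, hsymm]
        · simp [labelPath, hwM, hvM, h.segment_of_mem hw hwM, h.segment_of_notMem hD hvM, hsymm]
      · have hrec := ih w (h.ahead_real hw) (h.exists_parent_of_notMem hwM i)
        convert hrec using 1
        by_cases hvM : v ∈ M
        · simp [labelPath, hwM, hvM, h.segment_of_notMem hw hwM, h.segment_of_mem hD hvM, hsymm,
            sup_comm]
        · simp [labelPath, hwM, hvM, h.segment_of_notMem hw hwM, h.segment_of_notMem hD hvM, hsymm,
            sup_assoc, sup_left_comm]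
    · exact ⟨(i, v), ⟨w, hw, hD⟩, rfl⟩

theorem treePaths_subset : treePaths G M p ⊆
    (fun a : Fin 3 × V => h.labelPath a.1 a.2) '' labels p := by
  rintro P ⟨hne, ⟨v, hv, i, hS⟩ | ⟨v, hv, i, j, S, S', hij, hS, hS', rfl⟩⟩
  · obtain rfl := h.eq_segment hS
    obtain ⟨e, he⟩ := hne
    have := h.labelPath_mem_image i v (h.exists_parent_of_edge_segment he)
    rwa [labelPath, if_pos hv] at this
  · obtain rfl := h.eq_segment hS
    obtain rfl := h.eq_segment hS'
    have hcyc : ∀ i j : Fin 3, i ≠ j → j = i + 1 ∨ i = j + 1 := by decide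
    rcases hcyc i j hij with rfl | rfl
    · have := h.labelPath_mem_image i v (h.exists_parent_of_notMem hv i)
      rwa [labelPath, if_neg hv] at this
    · have := h.labelPath_mem_image j v (h.exists_parent_of_notMem hv j)
      rwa [labelPath, if_neg hv, sup_comm] at this

/-- Two trees never use a link in the same direction, and one tree never uses it in both. Two labels
on one link thus have distinct indices and opposite directions; distinct indices are cyclically
consecutive in `Fin 3`, so one of the labels is excluded. -/
theorem ncard_labels_le : (labels p).ncard ≤ (treeLinks G p).ncard := by
  classical
  have hex (a : Fin 3 × V) : ∃ e : Sym2 V, ∀ w, p a.1 (.real a.2) = .real w → e = s(a.2, w) := by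
    by_cases ha : ∃ w, p a.1 (.real a.2) = .real w
    · obtain ⟨w, hw⟩ := ha
      exact ⟨s(a.2, w), fun w' hw' => by simp_all⟩
    -- A junk value, never taken on `labels p`.
    · exact ⟨s(a.2, a.2), fun w hw => absurd ⟨w, hw⟩ ha⟩
  choose link hlink using hex
  refine Set.ncard_le_ncard_of_injOn link ?_ ?_ (Set.toFinite _)
  · rintro a ⟨w, hw, -⟩
    rw [hlink a w hw]
    exact h.mem_treeLinks hw
  · rintro ⟨i, v⟩ ⟨w, hw, hD⟩ ⟨j, v'⟩ ⟨w', hw', hD'⟩ heq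
    rw [hlink _ w hw, hlink _ w' hw', Sym2.eq_iff] at heq
    simp only at hw hw' hD hD' heq
    rcases heq with ⟨rfl, rfl⟩ | ⟨rfl, rfl⟩
    · rw [h.eq_index_of_parent_eq hw hw']
    · have hcyc : ∀ i j : Fin 3, i ≠ j → j = i + 1 ∨ i = j + 1 := by decide
      rcases hcyc i j (h.ne_index_of_parent_swap hw hw') with rfl | rfl
      · exact absurd hw' hD
      · exact absurd hw hD'

theorem ncard_stpcPaths_le (aux : Sym2 V → G.Subgraph) :
    (stpcPaths G M p aux).ncard ≤ G.edgeSet.ncard := by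
  have h1 : (treePaths G M p).ncard ≤ (treeLinks G p).ncard :=
    ((Set.ncard_le_ncard h.treePaths_subset (Set.toFinite _)).trans
      (Set.ncard_image_le (Set.toFinite _))).trans h.ncard_labels_le
  have h2 : (aux '' (G.edgeSet \ treeLinks G p)).ncard ≤ (G.edgeSet \ treeLinks G p).ncard :=
    Set.ncard_image_le (Set.toFinite _)
  have h3 : (G.edgeSet \ treeLinks G p).ncard + (treeLinks G p).ncard = G.edgeSet.ncard :=
    Set.ncard_sdiff_add_ncard_of_subset (fun l hl => hl.1) (Set.toFinite _)
  have h4 := Set.ncard_union_le (treePaths G M p) (aux '' (G.edgeSet \ treeLinks G p))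
  rw [stpcPaths]
  omega

end IsDirected

theorem IsDirected.stpc_properties {V : Type*} [Fintype V] [DecidableEq V] {G : SimpleGraph V}
    [DecidableRel G.Adj] {M : Set V} {μ₂ : V} {p : Fin 3 → ExtNode V → ExtNode V}
    {f g : ExtNode V → ℕ} (h : IsDirected G M μ₂ p f g) (aux : Sym2 V → G.Subgraph)
    (haux : ∀ l ∈ G.edgeSet \ treeLinks G p, IsAuxPath G M p l (aux l)) :
    (∀ P ∈ stpcPaths G M p aux, IsMeasurementPath G M P) ∧
      (stpcPaths G M p aux).ncard = G.edgeFinset.card ∧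
      LinearIndependent ℝ (measurementMatrix G (stpcPaths G M p aux)).row ∧
      (measurementMatrix G (stpcPaths G M p aux)).rank = G.edgeFinset.card := by
  refine ⟨?_, measurementMatrix_of_span_eq_top (h.top_le_span haux) ?_⟩
  · rintro P (hP | ⟨l, hl, rfl⟩)
    · exact h.isMeasurementPath_of_mem_treePaths hP
    · exact (haux l hl).1
  · rw [← Set.ncard_coe_finset, SimpleGraph.coe_edgeFinset]
    exact h.ncard_stpcPaths_le aux


/-! ### The s-t numbering -/

section Step

variable {W : Type*} {H : SimpleGraph W} {f : W → ℕ} {C : Set W} {P I : List W} {a b w x y z : W}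

theorem exists_eq_cons_append_singleton (h : 2 ≤ P.length) :
    ∃ a I b, P = a :: (I ++ [b]) := by
  obtain _ | ⟨a, t⟩ := P
  · simp at h
  · obtain rfl | ⟨I, b, rfl⟩ := List.eq_nil_or_concat t
    · simp at h
    · exact ⟨a, I, b, by simp⟩

@[simp]
theorem innerNodes_cons_append_singleton : innerNodes (a :: (I ++ [b])) = I := by
  simp [innerNodes]

@[simp]
theorem getLast?_cons_append_singleton : (a :: (I ++ [b])).getLast? = some b := by
  rw [← List.cons_append, List.getLast?_concat]

/-- The ear `P`, traversed from `a` through the nodes `I` to `b` in the direction of increasing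
numbers. -/
structure IsOriented (H : SimpleGraph W) (f : W → ℕ) (P : List W) (a : W) (I : List W) (b : W) :
    Prop where
  orient_eq : orient f P = a :: (I ++ [b])
  lt : f a < f b
  chain : (a :: (I ++ [b])).IsChain H.Adj
  nodup : (a :: (I ++ [b])).Nodup
  mem_inner : ∀ x, x ∈ innerNodes P ↔ x ∈ I
  mem : ∀ x, x ∈ P ↔ x = a ∨ x ∈ I ∨ x = b

theorem IsEarPath.exists_isOriented (h : IsEarPath H P)
    (hf : ∀ a ∈ P, ∀ b ∈ P, a ∉ innerNodes P → b ∉ innerNodes P → f a = f b → a = b) :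
    ∃ a I b, IsOriented H f P a I b := by
  obtain ⟨hlen, hnodup, hchain, -⟩ := h
  obtain ⟨a, I, b, rfl⟩ := exists_eq_cons_append_singleton hlen
  by_cases hab : f a < f b
  · exact ⟨a, I, b, by simp [orient, hab], hab, hchain, hnodup, by simp, by simp⟩
  · have hrev : (a :: (I ++ [b])).reverse = b :: (I.reverse ++ [a]) := by simp
    have hne : f a ≠ f b := by
      intro heq
      have hn := hnodup
      simp only [List.nodup_cons, List.mem_append, List.mem_singleton, List.nodup_append] at hn
      refine hn.1 (Or.inr (hf a (by simp) b (by simp) ?_ ?_ heq)) <;>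
        rw [innerNodes_cons_append_singleton]
      · exact fun ha => hn.1 (Or.inl ha)
      · exact fun hb => hn.2.2.2 b hb b rfl rfl
    refine ⟨b, I.reverse, a, by simp [orient, hab], by omega, ?_, ?_, by simp, ?_⟩
    · rw [← hrev, List.isChain_reverse]
      exact hchain.imp fun _ _ => SimpleGraph.Adj.symm
    · rwa [← hrev, List.nodup_reverse]
    · intro x
      simp only [List.mem_cons, List.mem_append, List.mem_reverse, List.not_mem_nil, or_false]
      tauto

/-- `f` numbers exactly the nodes in `C`, injectively. -/
structure IsNumbering (C : Set W) (f : W → ℕ) : Prop where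
  pos : ∀ w, 0 < f w ↔ w ∈ C
  inj : Set.InjOn f C

namespace IsOriented

variable (h : IsOriented H f P a I b)
include h

open Classical in
theorem stStep_eq : stStep f P w = if w ∈ I then f b + I.idxOf w
    else if f b ≤ f w then f w + I.length else f w := by
  simp [stStep, h.orient_eq]

theorem stStep_of_notMem (hw : w ∉ I) :
    stStep f P w = if f b ≤ f w then f w + I.length else f w := by
  rw [h.stStep_eq, if_neg hw]

variable (hI : ∀ x ∈ I, x ∉ C)
include hI

theorem stStep_lt_stStep (hx : x ∈ C) (hy : y ∈ C) (hxy : f x < f y) :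
    stStep f P x < stStep f P y := by
  rw [h.stStep_of_notMem fun h' => hI x h' hx, h.stStep_of_notMem fun h' => hI y h' hy]
  split_ifs <;> omega

theorem stStep_lt_inner (hx : x ∈ I) (hy : y ∈ C) (hyb : f y < f b) :
    stStep f P y < stStep f P x := by
  rw [h.stStep_of_notMem fun h' => hI y h' hy, h.stStep_eq, if_pos hx]
  split_ifs <;> omega

theorem inner_lt_stStep (hx : x ∈ I) (hy : y ∈ C) (hyb : f b ≤ f y) :
    stStep f P x < stStep f P y := by
  classical
  rw [h.stStep_of_notMem fun h' => hI y h' hy, h.stStep_eq, if_pos hx, if_pos hyb]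
  have := List.idxOf_lt_length_iff.2 hx
  omega

/-- The internal nodes fill the gap starting at `f b` that is opened by raising the numbers from `f
b` on. Unnumbered nodes carry 0, below `f b`, and hence are not raised. -/
theorem isNumbering (hC : IsNumbering C f) (hb : b ∈ C) :
    IsNumbering (C ∪ {x | x ∈ I}) (stStep f P) := by
  classical
  have hb0 := (hC.pos b).2 hb
  refine ⟨fun w => ?_, fun x hx y hy hxy => ?_⟩
  · by_cases hw : w ∈ I
    · rw [h.stStep_eq, if_pos hw]
      exact ⟨fun _ => Or.inr hw, fun _ => by omega⟩
    · rw [h.stStep_of_notMem hw]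
      have := hC.pos w
      simp only [Set.mem_union, Set.mem_ofPred_eq, hw, or_false, ← this]
      split_ifs <;> omega
  · rcases hx with hx | hx <;> rcases hy with hy | hy
    · by_contra hne
      rcases lt_or_gt_of_ne fun h' => hne (hC.inj hx hy h') with hlt | hlt
      · exact (h.stStep_lt_stStep hI hx hy hlt).ne hxy
      · exact (h.stStep_lt_stStep hI hy hx hlt).ne' hxy
    · rcases lt_or_ge (f x) (f b) with hlt | hle
      · exact absurd hxy (h.stStep_lt_inner hI hy hx hlt).ne
      · exact absurd hxy (h.inner_lt_stStep hI hy hx hle).ne'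
    · rcases lt_or_ge (f y) (f b) with hlt | hle
      · exact absurd hxy (h.stStep_lt_inner hI hx hy hlt).ne'
      · exact absurd hxy (h.inner_lt_stStep hI hx hy hle).ne
    · change x ∈ I at hx
      change y ∈ I at hy
      rw [h.stStep_eq, if_pos hx, h.stStep_eq, if_pos hy] at hxy
      exact (List.idxOf_inj hx).1 (by omega)

/-- The two neighbours along the ear work: numbers increase by one inside the block, `a` stays below
it, and `b` is raised above it. -/
theorem exists_neighbors (ha : a ∈ C) (hb : b ∈ C) (hx : x ∈ I) :
    ∃ y z, (y = a ∨ y ∈ I) ∧ (z ∈ I ∨ z = b) ∧ H.Adj x y ∧ H.Adj x z ∧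
      stStep f P y < stStep f P x ∧ stStep f P x < stStep f P z := by
  classical
  have hidx {s t : List W} {u : W} (hn : (s ++ u :: t).Nodup) : (s ++ u :: t).idxOf u = s.length := by
    have hu : u ∉ s := fun hu =>
      (List.nodup_append.1 hn).2.2 u hu u (by simp) rfl
    rw [List.idxOf_append_of_notMem hu, List.idxOf_cons_self, add_zero]
  obtain ⟨s, t, rfl⟩ := List.append_of_mem hx
  have hn : (s ++ x :: t).Nodup := by
    have := h.nodup
    rw [List.nodup_cons] at this
    exact (List.nodup_append.1 this.2).1
  have hy : ∃ y, (y = a ∨ y ∈ s ++ x :: t) ∧ H.Adj x y ∧ stStep f P y < stStep f P x := by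
    have hch := h.chain
    obtain rfl | ⟨s, y, rfl⟩ := List.eq_nil_or_concat s
    · refine ⟨a, Or.inl rfl, ?_, h.stStep_lt_inner hI hx ha h.lt⟩
      simp only [List.nil_append, List.cons_append, List.isChain_cons_cons] at hch
      exact hch.1.symm
    · refine ⟨y, Or.inr (by simp), ?_, ?_⟩
      · rw [show a :: (s.concat y ++ x :: t ++ [b]) = (a :: s) ++ y :: x :: (t ++ [b]) by simp,
          List.isChain_append_cons_cons] at hch
        exact hch.2.1.symm
      · rw [h.stStep_eq, if_pos (by simp), h.stStep_eq, if_pos hx, hidx hn]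
        rw [show s.concat y ++ x :: t = s ++ y :: (x :: t) by simp] at hn ⊢
        rw [hidx hn]
        simp
  have hz : ∃ z, (z ∈ s ++ x :: t ∨ z = b) ∧ H.Adj x z ∧ stStep f P x < stStep f P z := by
    have hch := h.chain
    obtain _ | ⟨z, t⟩ := t
    · refine ⟨b, Or.inr rfl, ?_, h.inner_lt_stStep hI hx hb le_rfl⟩
      rw [show a :: (s ++ [x] ++ [b]) = (a :: s) ++ x :: b :: [] by simp,
        List.isChain_append_cons_cons] at hch
      exact hch.2.1
    · refine ⟨z, Or.inl (by simp), ?_, ?_⟩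
      · rw [show a :: (s ++ x :: z :: t ++ [b]) = (a :: s) ++ x :: z :: (t ++ [b]) by simp,
          List.isChain_append_cons_cons] at hch
        exact hch.2.1
      · rw [h.stStep_eq, if_pos hx, h.stStep_eq, if_pos (by simp), hidx hn]
        rw [show s ++ x :: z :: t = (s ++ [x]) ++ z :: t by simp] at hn ⊢
        rw [hidx hn]
        simp
  obtain ⟨y, hy, hxy, hlt⟩ := hy
  obtain ⟨z, hz, hxz, hlt'⟩ := hz
  exact ⟨y, z, hy, hz, hxy, hxz, hlt, hlt'⟩

end IsOriented

end Step

/-! ### Levels -/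

section Level

variable {W : Type*} {H : SimpleGraph W} {n k : ℕ} {E : ℕ → List W} {v : W}

theorem covered_mono {i j : ℕ} (h : i ≤ j) : covered E i ⊆ covered E j :=
  fun _ ⟨k, h1, h2, h3⟩ => ⟨k, h1, h2.trans h, h3⟩

theorem mem_covered_succ : v ∈ covered E (k + 1) ↔ v ∈ covered E k ∨ v ∈ E (k + 1) := by
  constructor
  · rintro ⟨j, h1, h2, h3⟩
    rcases h2.eq_or_lt with rfl | h2
    · exact Or.inr h3
    · exact Or.inl ⟨j, h1, by omega, h3⟩
  · rintro (h | h)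
    · exact covered_mono (Nat.le_succ k) h
    · exact ⟨k + 1, by omega, le_rfl, h⟩

theorem mem_covered_one : v ∈ covered E 1 ↔ v ∈ E 1 := by
  rw [mem_covered_succ (k := 0)]
  refine or_iff_right ?_
  rintro ⟨j, h1, h2, -⟩
  omega

theorem mem_covered_of_mem_one (hk : 1 ≤ k) (hv : v ∈ E 1) : v ∈ covered E k :=
  covered_mono hk (mem_covered_one.2 hv)

namespace IsNonsepEarDecomp

variable (h : IsNonsepEarDecomp H n E)
include h

theorem earLevel_mem (v : W) : 1 ≤ earLevel n E v ∧ earLevel n E v ≤ n ∧ v ∈ E (earLevel n E v) :=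
  Nat.sInf_mem (s := {i | 1 ≤ i ∧ i ≤ n ∧ v ∈ E i}) (h.cover v)

theorem mem_covered_iff (hk : k ≤ n) : v ∈ covered E k ↔ earLevel n E v ≤ k := by
  constructor
  · rintro ⟨j, h1, h2, h3⟩
    exact (Nat.sInf_le (s := {i | 1 ≤ i ∧ i ≤ n ∧ v ∈ E i}) ⟨h1, h2.trans hk, h3⟩).trans h2
  · intro hv
    obtain ⟨h1, -, h3⟩ := h.earLevel_mem v
    exact ⟨_, h1, hv, h3⟩

theorem mem_innerNodes (hv : 2 ≤ earLevel n E v) : v ∈ innerNodes (E (earLevel n E v)) := by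
  obtain ⟨-, h2, h3⟩ := h.earLevel_mem v
  by_contra hin
  have := (h.ends _ hv h2 v h3).2 hin
  rw [h.mem_covered_iff (by omega)] at this
  omega

theorem exists_neighbor_of_lt (hv : earLevel n E v < n) :
    ∃ w, H.Adj v w ∧ earLevel n E v < earLevel n E w := by
  obtain ⟨h1, h2, h3⟩ := h.earLevel_mem v
  have key : ∃ w, H.Adj v w ∧ w ∉ covered E (earLevel n E v) := by
    rcases h1.eq_or_lt with h1 | h1
    · rw [← h1] at h3 ⊢
      exact h.nbr_cycle v h3
    · exact h.nbr_path _ h1 hv v (h.mem_innerNodes h1)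
  obtain ⟨w, hvw, hw⟩ := key
  rw [h.mem_covered_iff h2, not_le] at hw
  exact ⟨w, hvw, hw⟩

end IsNonsepEarDecomp

end Level

/-! ### The numbering of the augmented graph -/

/-- A numbering in which the root comes first, `vm₂` second and `vm₁` last. -/
structure IsSTNumbering {V : Type*} (C : Set (ExtNode V)) (f : ExtNode V → ℕ) : Prop
    extends IsNumbering C f where
  root_lt : ∀ w ∈ C, w ≠ .root → f .root < f w
  vm₂_lt : ∀ w ∈ C, w ≠ .root → w ≠ .vm₂ → f .vm₂ < f w
  lt_vm₁ : ∀ w ∈ C, w ≠ .vm₁ → f w < f .vm₁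

theorem stNum_succ {V : Type*} {μ₁ : V} {E : ℕ → List (ExtNode V)} {k : ℕ} (hk : 1 ≤ k) :
    stNum μ₁ E (k + 1) = stStep (stNum μ₁ E k) (E (k + 1)) := by
  obtain ⟨m, rfl⟩ := Nat.exists_eq_add_of_le' hk
  rfl

namespace IsEarInput

variable {V : Type*} {G : SimpleGraph V} {M : Set V} {μ₁ μ₂ : V} {n : ℕ}
  {E : ℕ → List (ExtNode V)} (h : IsEarInput G M μ₁ μ₂ n E)
include h

theorem earLevel_of_mem_first {v : ExtNode V} (hv : v ∈ E 1) : earLevel n E v = 1 := by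
  have h2 := h.decomp.two_le
  have := (h.decomp.mem_covered_iff (v := v) (show 1 ≤ n by omega)).1 (mem_covered_one.2 hv)
  have := (h.decomp.earLevel_mem v).1
  omega

theorem isSTNumbering_one : IsSTNumbering (covered E 1) (stNum μ₁ E 1) := by
  have hcov (v) : v ∈ covered E 1 ↔ v = .root ∨ v = .vm₁ ∨ v = .real μ₁ ∨ v = .vm₂ := by
    rw [mem_covered_one, h.first]
    simp
  refine ⟨⟨?_, ?_⟩, ?_, ?_, ?_⟩
  · rintro (v | _ | _ | _) <;> simp [hcov, stNum, stInit]
    split_ifs <;> simp_all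
  · intro x hx y hy hxy
    rw [hcov] at hx hy
    rcases hx with rfl | rfl | rfl | rfl <;> rcases hy with rfl | rfl | rfl | rfl <;>
      simp_all [stNum, stInit]
  all_goals
    intro x hx
    rw [hcov] at hx
    rcases hx with rfl | rfl | rfl | rfl <;> simp [stNum, stInit]

theorem exists_isOriented {k : ℕ} (hk : 1 ≤ k) (hkn : k < n)
    (hC : IsNumbering (covered E k) (stNum μ₁ E k)) :
    ∃ a I b, IsOriented (extGraph G M μ₂) (stNum μ₁ E k) (E (k + 1)) a I b ∧
      a ∈ covered E k ∧ b ∈ covered E k ∧ (∀ x ∈ I, x ∉ covered E k) ∧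
      covered E (k + 1) = covered E k ∪ {x | x ∈ I} := by
  have hends := h.decomp.ends (k + 1) (by omega) hkn
  simp only [Nat.add_sub_cancel] at hends
  obtain ⟨a, I, b, ho⟩ := (h.decomp.path (k + 1) (by omega) hkn).exists_isOriented
    (f := stNum μ₁ E k) fun a ha b hb ha' hb' hab =>
      hC.inj ((hends a ha).2 ha') ((hends b hb).2 hb') hab
  have hn := ho.nodup
  simp only [List.nodup_cons, List.mem_append, List.mem_singleton, List.nodup_append] at hn
  have ha : a ∈ covered E k := by
    rw [hends a ((ho.mem a).2 (Or.inl rfl)), ho.mem_inner]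
    exact fun ha => hn.1 (Or.inl ha)
  have hb : b ∈ covered E k := by
    rw [hends b ((ho.mem b).2 (Or.inr (Or.inr rfl))), ho.mem_inner]
    exact fun hb => hn.2.2.2 b hb b rfl rfl
  refine ⟨a, I, b, ho, ha, hb, fun x hx hx' => ?_, ?_⟩
  · rw [hends x ((ho.mem x).2 (Or.inr (Or.inl hx))), ho.mem_inner] at hx'
    exact hx' hx
  · ext x
    rw [mem_covered_succ, ho.mem]
    simp only [Set.mem_union, Set.mem_ofPred_eq]
    constructor
    · rintro (hx | rfl | hx | rfl)
      exacts [Or.inl hx, Or.inl ha, Or.inr hx, Or.inl hb]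
    · rintro (hx | hx)
      exacts [Or.inl hx, Or.inr (Or.inr (Or.inl hx))]

/-- No ear with internal nodes runs from the root to `vm₂`. -/
theorem inner_eq_nil_of_root_vm₂ {k : ℕ} {f : ExtNode V → ℕ} {I : List (ExtNode V)} (hk : 1 ≤ k)
    (hkn : k < n) (ho : IsOriented (extGraph G M μ₂) f (E (k + 1)) .root I .vm₂)
    (hI : ∀ x ∈ I, x ∉ covered E k) : I = [] := by
  obtain _ | ⟨y, I⟩ := I
  · rfl
  exfalso
  have hadj : (extGraph G M μ₂).Adj .root y := by
    have := ho.chain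
    rw [List.cons_append, List.isChain_cons_cons] at this
    exact this.1
  have hy := hI y (by simp)
  have hvm₁ := mem_covered_of_mem_one hk (E := E) (v := .vm₁) (by simp [h.first])
  have hvm₂ := mem_covered_of_mem_one hk (E := E) (v := .vm₂) (by simp [h.first])
  -- Of the three neighbours of the root, `vm₁` and `vm₂` are already covered.
  obtain rfl : y = .real μ₂ := by
    rcases y with y | _ | _ | _
    · rw [show y = μ₂ from hadj]
    · exact absurd hvm₁ hy
    · exact absurd hvm₂ hy
    · exact hadj.elim
  obtain ⟨a, b, hlast, hab⟩ := h.last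
  have hkn' : k + 1 = n := by
    by_contra hne
    refine h.decomp.last_inner (.real μ₂) (by simp [hlast, innerNodes]) (k + 1) (by omega)
      (by omega) ((ho.mem _).2 (by simp))
  have hmem := ho.mem
  rw [hkn', hlast] at hmem
  have hr := (hmem .root).2 (by simp)
  have hv := (hmem .vm₂).2 (by simp)
  simp only [List.mem_cons, List.not_mem_nil, or_false, reduceCtorEq, false_or] at hr hv
  -- The ends of the last ear are the root and `vm₂` in some order, and these are adjacent.
  rcases hr with rfl | rfl <;> rcases hv with hv | hv
  · cases hv
  · exact hab (hv ▸ trivial)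
  · exact hab (hv ▸ trivial)
  · cases hv

/-- A new block goes just below the old position of `b`, which is at most that of `vm₁`. It can
violate the order only if `b` is the root, impossible since `a` is smaller, or if `b` is `vm₂`; then
`a` is the root and the block is empty. -/
theorem isSTNumbering_succ {k : ℕ} (hk : 1 ≤ k) (hkn : k < n)
    (hC : IsSTNumbering (covered E k) (stNum μ₁ E k)) :
    IsSTNumbering (covered E (k + 1)) (stNum μ₁ E (k + 1)) := by
  obtain ⟨a, I, b, ho, ha, hb, hI, hcov⟩ := h.exists_isOriented hk hkn hC.toIsNumbering
  have hroot := mem_covered_of_mem_one hk (E := E) (v := .root) (by simp [h.first])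
  have hvm₁ := mem_covered_of_mem_one hk (E := E) (v := .vm₁) (by simp [h.first])
  have hvm₂ := mem_covered_of_mem_one hk (E := E) (v := .vm₂) (by simp [h.first])
  have hrb : stNum μ₁ E k .root < stNum μ₁ E k b := by
    refine hC.root_lt b hb ?_
    rintro rfl
    have hlt := ho.lt
    by_cases har : a = .root
    · exact hlt.ne (congrArg _ har)
    · exact (hC.root_lt a ha har).not_gt hlt
  rw [stNum_succ hk, hcov]
  refine ⟨ho.isNumbering hI hC.toIsNumbering hb, ?_, ?_, ?_⟩
  · rintro w (hw | hw) hwr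
    · exact ho.stStep_lt_stStep hI hroot hw (hC.root_lt w hw hwr)
    · exact ho.stStep_lt_inner hI hw hroot hrb
  · rintro w (hw | hw) hwr hwv
    · exact ho.stStep_lt_stStep hI hvm₂ hw (hC.vm₂_lt w hw hwr hwv)
    · refine ho.stStep_lt_inner hI hw hvm₂ (hC.vm₂_lt b hb ?_ ?_)
      · rintro rfl
        exact hrb.false
      · rintro rfl
        obtain rfl : a = .root := by
          by_contra har
          have hlt := ho.lt
          have hav : a ≠ .vm₂ := by
            rintro rfl
            exact hlt.false
          exact (hC.vm₂_lt a ha har hav).not_gt hlt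
        rw [h.inner_eq_nil_of_root_vm₂ hk hkn ho hI] at hw
        simp at hw
  · rintro w (hw | hw) hwv
    · exact ho.stStep_lt_stStep hI hw hvm₁ (hC.lt_vm₁ w hw hwv)
    · refine ho.inner_lt_stStep hI hw hvm₁ ?_
      by_cases hbv : b = .vm₁
      · rw [hbv]
      · exact (hC.lt_vm₁ b hb hbv).le

theorem isSTNumbering {k : ℕ} (hk : 1 ≤ k) (hkn : k ≤ n) :
    IsSTNumbering (covered E k) (stNum μ₁ E k) := by
  induction k, hk using Nat.le_induction with
  | base => exact h.isSTNumbering_one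
  | succ k hk ih => exact h.isSTNumbering_succ hk hkn (ih (by omega))

/-- Comparisons made when an ear is processed remain valid in the final numbering. -/
theorem stNum_lt_stNum {k m : ℕ} (hk : 1 ≤ k) (hkm : k ≤ m) (hmn : m ≤ n) {x y : ExtNode V}
    (hx : x ∈ covered E k) (hy : y ∈ covered E k) (hxy : stNum μ₁ E k x < stNum μ₁ E k y) :
    stNum μ₁ E m x < stNum μ₁ E m y := by
  induction m, hkm using Nat.le_induction with
  | base => exact hxy
  | succ m hm ih =>
    obtain ⟨a, I, b, ho, -, -, hI, -⟩ := h.exists_isOriented (hk.trans hm) hmn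
      (h.isSTNumbering (hk.trans hm) (by omega)).toIsNumbering
    rw [stNum_succ (hk.trans hm)]
    exact ho.stStep_lt_stStep hI (covered_mono hm hx) (covered_mono hm hy) (ih (by omega))

/-- A node not on the first ear has neighbours of no larger level on both sides. -/
theorem exists_neighbors {v : ExtNode V} (hv : 2 ≤ earLevel n E v) :
    ∃ y z, (extGraph G M μ₂).Adj v y ∧ (extGraph G M μ₂).Adj v z ∧
      stNum μ₁ E n y < stNum μ₁ E n v ∧ stNum μ₁ E n v < stNum μ₁ E n z ∧
      earLevel n E y ≤ earLevel n E v ∧ earLevel n E z ≤ earLevel n E v := by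
  have hle := (h.decomp.earLevel_mem v).2.1
  have hin := h.decomp.mem_innerNodes hv
  have hvc : v ∈ covered E (earLevel n E v) := (h.decomp.mem_covered_iff hle).2 le_rfl
  -- The ear first containing `v` is inserted into the numbering of the preceding ears, hence the
  -- shift by one.
  obtain ⟨k, hk⟩ := Nat.exists_eq_add_of_le' (show 1 ≤ earLevel n E v by omega)
  simp only [hk] at hin hvc hle hv ⊢
  have hk1 : 1 ≤ k := by omega
  obtain ⟨a, I, b, ho, ha, hb, hI, hcov⟩ := h.exists_isOriented hk1 hle
    (h.isSTNumbering hk1 (by omega)).toIsNumbering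
  obtain ⟨y, z, hy, hz, hvy, hvz, hlt, hlt'⟩ :=
    ho.exists_neighbors hI ha hb ((ho.mem_inner v).1 hin)
  have hyc : y ∈ covered E (k + 1) := by
    rw [hcov]
    rcases hy with rfl | hy
    exacts [Or.inl ha, Or.inr hy]
  have hzc : z ∈ covered E (k + 1) := by
    rw [hcov]
    rcases hz with hz | rfl
    exacts [Or.inr hz, Or.inl hb]
  rw [← stNum_succ hk1] at hlt hlt'
  exact ⟨y, z, hvy, hvz, h.stNum_lt_stNum (by omega) hle le_rfl hyc hvc hlt,
    h.stNum_lt_stNum (by omega) hle le_rfl hvc hzc hlt',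
    (h.decomp.mem_covered_iff hle).1 hyc, (h.decomp.mem_covered_iff hle).1 hzc⟩

theorem final : IsSTNumbering (covered E n) (stNum μ₁ E n) :=
  h.isSTNumbering (by have := h.decomp.two_le; omega) le_rfl

/-! ### Parents -/

/-- A node of top level is internal to the last ear, hence is `μ₂`; every other node has a neighbour
left uncovered by the ears up to its own level. -/
theorem exists_parent_up {v : ExtNode V} (hv : v ≠ .real μ₂) :
    ∃ w, (extGraph G M μ₂).Adj v w ∧ earLevel n E v < earLevel n E w := by
  refine h.decomp.exists_neighbor_of_lt (lt_of_le_of_ne (h.decomp.earLevel_mem v).2.1 fun hn => ?_)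
  have hin := h.decomp.mem_innerNodes (v := v) (by rw [hn]; exact h.decomp.two_le)
  obtain ⟨a, b, hlast, -⟩ := h.last
  rw [hn, hlast] at hin
  simp [innerNodes] at hin
  exact hv hin

theorem two_le_earLevel {u : V} (hu : u ≠ μ₁) : 2 ≤ earLevel n E (.real u) := by
  by_contra! hlt
  obtain ⟨h1, -, h3⟩ := h.decomp.earLevel_mem (.real u)
  rw [show earLevel n E (.real u) = 1 by omega, h.first] at h3
  simp [hu] at h3

/-- A monitor can use `vm₂`, and `vm₁` can use `μ₁`. A non-monitor is not `μ₁`, so it is internal to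
a later ear and has a lower neighbour; this is not the root, whose only real neighbour is the
monitor `μ₂`. -/
theorem exists_parent_down (hμ₁ : μ₁ ∈ M) (hμ₂ : μ₂ ∈ M) {v : ExtNode V} (hr : v ≠ .root)
    (hv : v ≠ .vm₂) : ∃ w, (extGraph G M μ₂).Adj v w ∧ w ≠ .root ∧
      stNum μ₁ E n w < stNum μ₁ E n v ∧ earLevel n E w ≤ earLevel n E v := by
  rcases v with u | _ | _ | _
  · by_cases hu : u ∈ M
    · refine ⟨.vm₂, hu, by simp, h.final.vm₂_lt _ (h.decomp.cover _) (by simp) (by simp), ?_⟩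
      rw [h.earLevel_of_mem_first (v := .vm₂) (by simp [h.first])]
      exact (h.decomp.earLevel_mem _).1
    · obtain ⟨y, -, hy, -, hlt, -, hle, -⟩ :=
        h.exists_neighbors (h.two_le_earLevel (u := u) (by rintro rfl; exact hu hμ₁))
      refine ⟨y, hy, ?_, hlt, hle⟩
      rintro rfl
      obtain rfl : u = μ₂ := hy
      exact hu hμ₂
  · refine ⟨.real μ₁, hμ₁, by simp, h.final.lt_vm₁ _ (h.decomp.cover _) (by simp), ?_⟩
    rw [h.earLevel_of_mem_first (v := .real μ₁) (by simp [h.first])]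
    exact (h.decomp.earLevel_mem _).1
  · exact absurd rfl hv
  · exact absurd rfl hr

theorem exists_parent_above (hμ₁ : μ₁ ∈ M) {v : ExtNode V} (hr : v ≠ .root)
    (hv : v ≠ .vm₁) : ∃ w, (extGraph G M μ₂).Adj v w ∧
      stNum μ₁ E n v < stNum μ₁ E n w ∧ earLevel n E w ≤ earLevel n E v := by
  rcases v with u | _ | _ | _
  · by_cases hu : u ∈ M
    · refine ⟨.vm₁, hu, h.final.lt_vm₁ _ (h.decomp.cover _) (by simp), ?_⟩
      rw [h.earLevel_of_mem_first (v := .vm₁) (by simp [h.first])]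
      exact (h.decomp.earLevel_mem _).1
    · obtain ⟨-, z, -, hz, -, hlt, -, hle⟩ :=
        h.exists_neighbors (h.two_le_earLevel (u := u) (by rintro rfl; exact hu hμ₁))
      exact ⟨z, hz, hlt, hle⟩
  · exact absurd rfl hv
  · refine ⟨.real μ₁, hμ₁, h.final.vm₂_lt _ (h.decomp.cover _) (by simp) (by simp), ?_⟩
    rw [h.earLevel_of_mem_first (v := .real μ₁) (by simp [h.first])]
    exact (h.decomp.earLevel_mem _).1
  · exact absurd rfl hr

theorem exists_isParentChoice (hμ₁ : μ₁ ∈ M) (hμ₂ : μ₂ ∈ M) :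
    ∃ p, IsParentChoice G M μ₁ μ₂ n E p := by
  classical
  have : Nonempty (ExtNode V) := ⟨.root⟩
  choose! q₁ hq₁ using fun v => h.exists_parent_up (v := v)
  choose! q₂ hq₂ using fun v => h.exists_parent_down hμ₁ hμ₂ (v := v)
  choose! q₃ hq₃ using fun v => h.exists_parent_above hμ₁ (v := v)
  refine ⟨![fun v => if v = .real μ₂ then .root else q₁ v, fun v => if v = .vm₂ then .root else q₂ v,
    fun v => if v = .vm₁ then .root else q₃ v], ?_, ?_, ?_, ?_, ?_, ?_⟩
  · simp
  · intro v _ hv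
    simpa [hv] using hq₁ v hv
  · simp
  · intro v hr hv
    simpa [hv] using hq₂ v hr hv
  · simp
  · intro v hr hv
    simpa [hv] using hq₃ v hr hv

theorem isDirected (hμ₂ : μ₂ ∈ M) {p : Fin 3 → ExtNode V → ExtNode V}
    (hp : IsParentChoice G M μ₁ μ₂ n E p) :
    IsDirected G M μ₂ p (stNum μ₁ E n) (earLevel n E) := by
  refine ⟨hμ₂, fun x y hxy => h.final.inj (h.decomp.cover x) (h.decomp.cover y) hxy, ?_, ?_⟩
  · intro i v hv
    fin_cases i
    · by_cases hv' : v = .real μ₂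
      · subst hv'
        simp only [Fin.zero_eta, hp.first₁]
        exact rfl
      · exact (hp.rule₁ v hv hv').1
    · by_cases hv' : v = .vm₂
      · subst hv'
        simp only [Fin.mk_one, hp.first₂]
        exact trivial
      · exact (hp.rule₂ v hv hv').1
    · by_cases hv' : v = .vm₁
      · subst hv'
        simp only [Fin.reduceFinMk, hp.first₃]
        exact trivial
      · exact (hp.rule₃ v hv hv').1
  -- A node whose parent is prescribed has the root as that parent, which `hr` excludes.
  · intro i v hv hr
    fin_cases i
    · exact (hp.rule₁ v hv fun hv' => hr (hv' ▸ hp.first₁)).2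
    · exact (hp.rule₂ v hv fun hv' => hr (hv' ▸ hp.first₂)).2.2
    · exact (hp.rule₃ v hv fun hv' => hr (hv' ▸ hp.first₃)).2

end IsEarInput

end STPC

theorem theorem1 {V : Type*} [Fintype V] [DecidableEq V] (G : SimpleGraph V) [DecidableRel G.Adj]
    (M : Set V) (μ₁ μ₂ : V) (hμ₁ : μ₁ ∈ M) (hμ₂ : μ₂ ∈ M) (hμ : μ₁ ≠ μ₂)
    (n : ℕ) (E : ℕ → List (STPC.ExtNode V)) (hE : STPC.IsEarInput G M μ₁ μ₂ n E) :
    (∃ p : Fin 3 → STPC.ExtNode V → STPC.ExtNode V, STPC.IsParentChoice G M μ₁ μ₂ n E p) ∧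
    ∀ p : Fin 3 → STPC.ExtNode V → STPC.ExtNode V, STPC.IsParentChoice G M μ₁ μ₂ n E p →
      STPC.AreIndepSpanningTrees (STPC.extGraph G M μ₂) STPC.ExtNode.root
        (fun i => STPC.parentGraph (p i)) ∧
      (∀ l ∈ G.edgeSet \ STPC.treeLinks G p, ∃ P, STPC.IsAuxPath G M p l P) ∧
      ∀ aux : Sym2 V → G.Subgraph,
        (∀ l ∈ G.edgeSet \ STPC.treeLinks G p, STPC.IsAuxPath G M p l (aux l)) →
        (∀ P ∈ STPC.stpcPaths G M p aux, STPC.IsMeasurementPath G M P) ∧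
        (STPC.stpcPaths G M p aux).ncard = G.edgeFinset.card ∧
        LinearIndependent ℝ (STPC.measurementMatrix G (STPC.stpcPaths G M p aux)).row ∧
        (STPC.measurementMatrix G (STPC.stpcPaths G M p aux)).rank = G.edgeFinset.card := by
  refine ⟨hE.exists_isParentChoice hμ₁ hμ₂, fun p hp => ?_⟩
  have h := hE.isDirected hμ₂ hp
  exact ⟨h.areIndepSpanningTrees, fun l hl => h.exists_isAuxPath hl.1, h.stpc_properties⟩
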